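/- Let $1<p<\infty$, let $L^p[0,1]$ be the complex $L^p$-space of Lebesgue measure on $[0,1]$, and call a bounded linear operator $T$ on $L^p[0,1]$ positive if $Tf\ge 0$ a.e. whenever $f\in L^p[0,1]$ satisfies $f\ge 0$ a.e. Let $\mathcal C_p$, $\mathcal I_p$ and $\mathcal U_p$ be the sets of positive contractions, positive (linear) isometries, and positive invertible isometries of $L^p[0,1]$, respectively. For a bounded operator $T$ let its weak limit semigroup be $$\mathcal L_T=\Bigl\{S:\ T^{n_k}\to S \text{ in the weak operator topology as } k\to\infty, \text{ for some strictly increasing sequence } (n_k) \text{ of natural numbers}\Bigr\}.$$ Let $V$ be a positive operator on $L^p[0,1]$. Suppose that at least one of the following holds, where WOT and SOT denote the weak and the strong operator topology: 1. the set of all $T\in\mathcal C_p$ with $V\in\mathcal L_T$ is dense in $(\mathcal C_p,\mathrm{WOT})$; 2. the set of all $T\in\mathcal I_p$ with $V\in\mathcal L_T$ is dense in $(\mathcal I_p,\mathrm{SOT})$; 3. the set of all $T\in\mathcal U_p$ with $V\in\mathcal L_T$ is dense in $(\mathcal U_p,\mathrm{SOT})$. Then $V=\lambda I$ for some $\lambda\in[0,1]$.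 -/

import Mathlib

open MeasureTheory Filter Topology
open scoped ENNReal

/-- The complex Banach space `L^p[0,1]` for Lebesgue measure. -/
noncomputable abbrev LpUnit (p : ℝ≥0∞) : Type :=
  Lp ℂ p (volume.restrict (Set.Icc (0 : ℝ) 1))

/-- `f ≥ 0` in `L^p[0,1]`: almost everywhere `f` is real-valued and non-negative. -/
def LpUnit.IsNonneg {p : ℝ≥0∞} (f : LpUnit p) : Prop :=
  ∀ᵐ x ∂(volume.restrict (Set.Icc (0 : ℝ) 1)), 0 ≤ (f x).re ∧ (f x).im = 0

/-- A (bounded linear) operator on `L^p[0,1]` is positive if it preserves non-negativity. -/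
def IsPositiveOperator {p : ℝ≥0∞} [Fact (1 ≤ p)] (T : LpUnit p →L[ℂ] LpUnit p) : Prop :=
  ∀ f : LpUnit p, f.IsNonneg → (T f).IsNonneg

/-- The set of positive contractions of `L^p[0,1]`. -/
def positiveContractions (p : ℝ≥0∞) [Fact (1 ≤ p)] : Set (LpUnit p →L[ℂ] LpUnit p) :=
  {T | IsPositiveOperator T ∧ ∀ f, ‖T f‖ ≤ ‖f‖}

/-- The set of (not necessarily surjective) positive isometries of `L^p[0,1]`. -/
def positiveIsometries (p : ℝ≥0∞) [Fact (1 ≤ p)] : Set (LpUnit p →L[ℂ] LpUnit p) :=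
  {T | IsPositiveOperator T ∧ ∀ f, ‖T f‖ = ‖f‖}

/-- The set of positive invertible (i.e. surjective) isometries of `L^p[0,1]`. -/
def positiveInvertibleIsometries (p : ℝ≥0∞) [Fact (1 ≤ p)] :
    Set (LpUnit p →L[ℂ] LpUnit p) :=
  {T | IsPositiveOperator T ∧ (∀ f, ‖T f‖ = ‖f‖) ∧ Function.Surjective T}

/-- The weak limit semigroup of `T`: all limits, in the weak operator topology, of `T ^ (n k)`
as `k → ∞` along strictly increasing sequences `n` of natural numbers. -/
def weakLimitSemigroup {E : Type*} [NormedAddCommGroup E] [NormedSpace ℂ E] (T : E →L[ℂ] E) :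
    Set (E →L[ℂ] E) :=
  {S | ∃ n : ℕ → ℕ, StrictMono n ∧
    Tendsto (fun k => (ContinuousLinearMapWOT.ofCLM (T ^ n k) : E →WOT[ℂ] E)) atTop
      (𝓝 (ContinuousLinearMapWOT.ofCLM S))}

/-- The members of `𝒳` that lie in `A` form a dense subset of the topological space
`(𝒳, WOT)`, where `𝒳` carries the subspace topology of the weak operator topology. -/
def IsWOTDenseIn {E : Type*} [NormedAddCommGroup E] [NormedSpace ℂ E]
    (A 𝒳 : Set (E →L[ℂ] E)) : Prop :=
  Dense {T : {T : E →WOT[ℂ] E // T.toCLM ∈ 𝒳} | T.1.toCLM ∈ A}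

/-- The members of `𝒳` that lie in `A` form a dense subset of the topological space
`(𝒳, SOT)`, where `𝒳` carries the subspace topology of the strong operator topology, that is, of
the topology of pointwise norm convergence. -/
def IsSOTDenseIn {E : Type*} [NormedAddCommGroup E] [NormedSpace ℂ E]
    (A 𝒳 : Set (E →L[ℂ] E)) : Prop :=
  Dense {T : {T : E →Lₚₜ[ℂ] E //
      (ContinuousLinearMap.toUniformConvergenceCLM (RingHom.id ℂ) E {s : Set E | Finite s}).symm T
        ∈ 𝒳} |
    (ContinuousLinearMap.toUniformConvergenceCLM (RingHom.id ℂ) E {s : Set E | Finite s}).symm T.1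
      ∈ A}

/-! If `V` is a weak limit of powers of `T`, then `V` commutes with `T`; if `T` is a contraction, so
is `V`. For fixed `V`, commuting with `V` is a closed condition on `T` in both WOT and SOT, so
density forces `V` to commute with the whole class. Each of the three classes contains all positive
invertible isometries, so the problem becomes one about their commutant.

The test operators are `f ↦ (φ')^(1/p) * (f ∘ φ)`, with `φ` piecewise affine, supported in `(a, b)`
and moving one point `s` to `t`. If `B` misses `(a, b)`, these fix `1_B`, hence fix `V 1_B`; then
the integral of `|V 1_B|^p` over `(a, s]` does not depend on `s`, so `V 1_B` vanishes on `(a, b)`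
(`apply_unitIndicator_eq_zero`). Splitting `1` at `t` gives `V 1_{x ≤ t} = 1_{x ≤ t} * V 1`
(`apply_unitIndicator_Iic`). Stretches of `(0, 1)` send `1_{x ≤ t}` to a multiple of `1_{x ≤ s}`,
which makes the integral of `|V 1|^p` over `[0, t]` linear in `t`; with positivity, `V 1` is a
constant `c ≥ 0` (`exists_apply_one_eq_const`). Thus `V` agrees with `c • id` on initial intervals,
whose indicators span a dense subspace, and contractivity gives `c ≤ 1`. -/

/-! ### Commutation and contractivity from density -/

section Operators

variable {E : Type*} [NormedAddCommGroup E] [NormedSpace ℂ E]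

theorem commute_of_mem_weakLimitSemigroup {T V : E →L[ℂ] E} (h : V ∈ weakLimitSemigroup T) (f : E) :
    V (T f) = T (V f) := by
  obtain ⟨n, -, hn⟩ := h
  rw [ContinuousLinearMapWOT.tendsto_iff_forall_dual_apply_tendsto] at hn
  refine (SeparatingDual.eq_iff_forall_dual_eq (R := ℂ)).2 fun y => ?_
  refine tendsto_nhds_unique (hn (T f) y) ?_
  refine (hn f (y.comp T)).congr fun k => ?_
  simp only [ContinuousLinearMapWOT.ofCLM_apply, ContinuousLinearMap.comp_apply]
  rw [← mul_apply_eq_comp, ← mul_apply_eq_comp, ← pow_succ, ← pow_succ']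

theorem norm_apply_le_of_mem_weakLimitSemigroup {T V : E →L[ℂ] E}
    (h : V ∈ weakLimitSemigroup T) (hT : ∀ f, ‖T f‖ ≤ ‖f‖) (f : E) : ‖V f‖ ≤ ‖f‖ := by
  obtain ⟨n, -, hn⟩ := h
  rw [ContinuousLinearMapWOT.tendsto_iff_forall_dual_apply_tendsto] at hn
  have hpow : ∀ m : ℕ, ‖(T ^ m) f‖ ≤ ‖f‖ := by
    intro m
    induction m with
    | zero => simp
    | succ m ih =>
      rw [pow_succ', mul_apply_eq_comp]
      exact (hT _).trans ih
  refine NormedSpace.norm_le_dual_bound (𝕜 := ℂ) _ (norm_nonneg _) fun y => ?_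
  refine le_of_tendsto (hn f y).norm (Eventually.of_forall fun k => ?_)
  rw [mul_comm]
  exact (y.le_opNorm _).trans (by gcongr; exact hpow _)

theorem IsWOTDenseIn.nonempty {A 𝒳 : Set (E →L[ℂ] E)} (h : IsWOTDenseIn A 𝒳) (hne : 𝒳.Nonempty) :
    (A ∩ 𝒳).Nonempty := by
  obtain ⟨T, hT⟩ := hne
  have : Nonempty {T : E →WOT[ℂ] E // T.toCLM ∈ 𝒳} := ⟨⟨.ofCLM T, hT⟩⟩
  obtain ⟨S, hS⟩ := Dense.nonempty h
  exact ⟨S.1.toCLM, hS, S.2⟩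

theorem IsSOTDenseIn.nonempty {A 𝒳 : Set (E →L[ℂ] E)} (h : IsSOTDenseIn A 𝒳) (hne : 𝒳.Nonempty) :
    (A ∩ 𝒳).Nonempty := by
  obtain ⟨T, hT⟩ := hne
  have : Nonempty {T : E →Lₚₜ[ℂ] E //
      (ContinuousLinearMap.toUniformConvergenceCLM (RingHom.id ℂ) E {s : Set E | Finite s}).symm T
        ∈ 𝒳} :=
    ⟨⟨ContinuousLinearMap.toUniformConvergenceCLM (RingHom.id ℂ) E {s : Set E | Finite s} T, hT⟩⟩
  obtain ⟨S, hS⟩ := Dense.nonempty h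
  exact ⟨_, hS, S.2⟩

/-- Tested against a functional `y`, both sides are WOT-continuous in `T`: on the left, `V` is
absorbed into the functional `y.comp V`. -/
theorem IsWOTDenseIn.commute {A 𝒳 : Set (E →L[ℂ] E)} (h : IsWOTDenseIn A 𝒳) {V : E →L[ℂ] E}
    (hA : ∀ T ∈ A, ∀ f, V (T f) = T (V f)) {T : E →L[ℂ] E} (hT : T ∈ 𝒳) (f : E) :
    V (T f) = T (V f) := by
  refine (SeparatingDual.eq_iff_forall_dual_eq (R := ℂ)).2 fun y => ?_
  have hc : IsClosed {S : {T : E →WOT[ℂ] E // T.toCLM ∈ 𝒳} | (y.comp V) (S.1 f) = y (S.1 (V f))} :=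
    isClosed_eq
      ((ContinuousLinearMapWOT.continuous_dual_apply f (y.comp V)).comp continuous_subtype_val)
      ((ContinuousLinearMapWOT.continuous_dual_apply (V f) y).comp continuous_subtype_val)
  exact hc.closure_subset_iff.2 (fun S hS => congrArg y (hA _ hS f))
    (h ⟨.ofCLM T, hT⟩)

theorem PointwiseConvergenceCLM.continuous_eval (f : E) :
    Continuous fun T : E →Lₚₜ[ℂ] E => T f :=
  (PointwiseConvergenceCLM.evalCLM (RingHom.id ℂ) E f).continuous

theorem IsSOTDenseIn.commute {A 𝒳 : Set (E →L[ℂ] E)} (h : IsSOTDenseIn A 𝒳) {V : E →L[ℂ] E}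
    (hA : ∀ T ∈ A, ∀ f, V (T f) = T (V f)) {T : E →L[ℂ] E} (hT : T ∈ 𝒳) (f : E) :
    V (T f) = T (V f) := by
  have hc : IsClosed {S : {T : E →Lₚₜ[ℂ] E //
      (ContinuousLinearMap.toUniformConvergenceCLM (RingHom.id ℂ) E {s : Set E | Finite s}).symm T
        ∈ 𝒳} | V (S.1 f) = S.1 (V f)} :=
    isClosed_eq
      (V.continuous.comp ((PointwiseConvergenceCLM.continuous_eval f).comp continuous_subtype_val))
      ((PointwiseConvergenceCLM.continuous_eval (V f)).comp continuous_subtype_val)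
  exact hc.closure_subset_iff.2 (fun S hS => hA _ hS f)
    (h ⟨ContinuousLinearMap.toUniformConvergenceCLM (RingHom.id ℂ) E {s : Set E | Finite s} T, hT⟩)

end Operators

theorem commute_and_contraction_of_dense {p : ℝ≥0∞} [Fact (1 ≤ p)]
    {V : LpUnit p →L[ℂ] LpUnit p}
    (hdense :
      IsWOTDenseIn {T | IsPositiveOperator T ∧ V ∈ weakLimitSemigroup T}
          (positiveContractions p) ∨
        IsSOTDenseIn {T | IsPositiveOperator T ∧ V ∈ weakLimitSemigroup T}
          (positiveIsometries p) ∨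
        IsSOTDenseIn {T | IsPositiveOperator T ∧ V ∈ weakLimitSemigroup T}
          (positiveInvertibleIsometries p)) :
    (∀ T ∈ positiveInvertibleIsometries p, ∀ f, V (T f) = T (V f)) ∧ ∀ f, ‖V f‖ ≤ ‖f‖ := by
  -- The identity lies in all three classes, so each is nonempty and density yields some `T` with
  -- `V` in its limit semigroup, whence the norm bound.
  have hid : ContinuousLinearMap.id ℂ (LpUnit p) ∈ positiveInvertibleIsometries p :=
    ⟨fun f hf => hf, fun f => rfl, fun f => ⟨f, rfl⟩⟩
  have hcomm : ∀ T ∈ {T | IsPositiveOperator T ∧ V ∈ weakLimitSemigroup T},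
      ∀ f, V (T f) = T (V f) := fun T hT f => commute_of_mem_weakLimitSemigroup hT.2 f
  rcases hdense with h | h | h
  · refine ⟨fun T hT f => h.commute hcomm ⟨hT.1, fun f => (hT.2.1 f).le⟩ f, fun f => ?_⟩
    obtain ⟨T, hT, hT'⟩ := h.nonempty ⟨_, hid.1, fun f => (hid.2.1 f).le⟩
    exact norm_apply_le_of_mem_weakLimitSemigroup hT.2 hT'.2 f
  · refine ⟨fun T hT f => h.commute hcomm ⟨hT.1, hT.2.1⟩ f, fun f => ?_⟩
    obtain ⟨T, hT, hT'⟩ := h.nonempty ⟨_, hid.1, hid.2.1⟩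
    exact norm_apply_le_of_mem_weakLimitSemigroup hT.2 (fun f => (hT'.2 f).le) f
  · refine ⟨fun T hT f => h.commute hcomm hT f, fun f => ?_⟩
    obtain ⟨T, hT, hT'⟩ := h.nonempty ⟨_, hid⟩
    exact norm_apply_le_of_mem_weakLimitSemigroup hT.2 (fun f => (hT'.2.1 f).le) f

/-! ### Weighted composition isometries -/

section WeightedComposition

variable {α : Type*} {φ : α → α} {w : α → ℝ} {p : ℝ≥0∞}

/-- The function `w ^ (1 / p) * (f ∘ φ)`. -/
noncomputable def weightedCompFun (p : ℝ≥0∞) (φ : α → α) (w : α → ℝ) (f : α → ℂ) (x : α) : ℂ :=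
  ((w x ^ (1 / p.toReal) : ℝ) : ℂ) * f (φ x)

theorem enorm_weightedCompFun_rpow (hp0 : p ≠ 0) (hp : p ≠ ∞) (hpos : ∀ x, 0 < w x)
    (f : α → ℂ) (x : α) :
    ‖weightedCompFun p φ w f x‖ₑ ^ p.toReal
      = ENNReal.ofReal (w x) * ‖f (φ x)‖ₑ ^ p.toReal := by
  have hp' : 0 < p.toReal := ENNReal.toReal_pos hp0 hp
  have h0 : 0 ≤ w x ^ (1 / p.toReal) := Real.rpow_nonneg (hpos x).le _
  rw [weightedCompFun, enorm_mul, ENNReal.mul_rpow_of_nonneg _ _ hp'.le]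
  congr 1
  rw [← ofReal_norm, Complex.norm_real, Real.norm_of_nonneg h0,
    ENNReal.ofReal_rpow_of_nonneg h0 hp'.le, ← Real.rpow_mul (hpos x).le,
    one_div_mul_cancel hp'.ne', Real.rpow_one]

variable [MeasurableSpace α] {μ : Measure α}

/-- Positivity of `w` makes `μ` absolutely continuous with respect to `w μ`. This is what makes `f ∘
φ` well defined on a.e. classes. -/
theorem MeasureTheory.MeasurePreserving.quasiMeasurePreserving_of_withDensity
    (hw : Measurable w) (hpos : ∀ x, 0 < w x)
    (hφ : MeasurePreserving φ (μ.withDensity fun x => ENNReal.ofReal (w x)) μ) :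
    Measure.QuasiMeasurePreserving φ μ μ :=
  hφ.quasiMeasurePreserving.mono_left
    (withDensity_absolutelyContinuous' hw.ennreal_ofReal.aemeasurable
      (ae_of_all _ fun x => (ENNReal.ofReal_pos.2 (hpos x)).ne'))

theorem weightedCompFun_congr_ae (hw : Measurable w) (hpos : ∀ x, 0 < w x)
    (hφ : MeasurePreserving φ (μ.withDensity fun x => ENNReal.ofReal (w x)) μ) {f g : α → ℂ}
    (h : f =ᵐ[μ] g) : weightedCompFun p φ w f =ᵐ[μ] weightedCompFun p φ w g := by
  filter_upwards [(hφ.quasiMeasurePreserving_of_withDensity hw hpos).ae_eq_comp h] with x hx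
  exact congrArg _ hx

/-- Change of variables, as `φ` pushes `w μ` to `μ`. The local form over `s` is needed to compare
masses of subintervals; `s = univ` gives the isometry property. -/
theorem setLIntegral_weightedCompFun (hp0 : p ≠ 0) (hp : p ≠ ∞) (hw : Measurable w)
    (hpos : ∀ x, 0 < w x)
    (hφ : MeasurePreserving φ (μ.withDensity fun x => ENNReal.ofReal (w x)) μ) {f : α → ℂ}
    (hf : AEStronglyMeasurable f μ) {s : Set α} (hs : MeasurableSet s) :
    ∫⁻ x in φ ⁻¹' s, ‖weightedCompFun p φ w f x‖ₑ ^ p.toReal ∂μ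
      = ∫⁻ x in s, ‖f x‖ₑ ^ p.toReal ∂μ := by
  have hm : AEMeasurable (fun x => s.indicator (fun x => ‖f x‖ₑ ^ p.toReal) x) μ :=
    (hf.enorm.pow_const _).indicator hs
  rw [← lintegral_indicator hs, ← lintegral_indicator (hφ.measurable hs)]
  conv_rhs => rw [← hφ.map_eq]
  have hc : AEMeasurable (fun x => s.indicator (fun x => ‖f x‖ₑ ^ p.toReal) (φ x)) μ :=
    hm.comp_quasiMeasurePreserving (hφ.quasiMeasurePreserving_of_withDensity hw hpos)
  rw [lintegral_map' (by rwa [hφ.map_eq]) hφ.aemeasurable,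
    lintegral_withDensity_eq_lintegral_mul₀ hw.ennreal_ofReal.aemeasurable hc]
  refine lintegral_congr fun x => ?_
  by_cases hx : φ x ∈ s
  · rw [Set.indicator_of_mem (show x ∈ φ ⁻¹' s from hx), enorm_weightedCompFun_rpow hp0 hp hpos]
    simp [hx]
  · rw [Set.indicator_of_notMem (show x ∉ φ ⁻¹' s from hx)]
    simp [hx]

theorem eLpNorm_weightedCompFun (hp0 : p ≠ 0) (hp : p ≠ ∞) (hw : Measurable w)
    (hpos : ∀ x, 0 < w x)
    (hφ : MeasurePreserving φ (μ.withDensity fun x => ENNReal.ofReal (w x)) μ) {f : α → ℂ}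
    (hf : AEStronglyMeasurable f μ) :
    eLpNorm (weightedCompFun p φ w f) p μ = eLpNorm f p μ := by
  rw [eLpNorm_eq_lintegral_rpow_enorm_toReal hp0 hp, eLpNorm_eq_lintegral_rpow_enorm_toReal hp0 hp]
  simpa using congrArg (· ^ (1 / p.toReal))
    (setLIntegral_weightedCompFun hp0 hp hw hpos hφ hf MeasurableSet.univ)

theorem MeasureTheory.MemLp.weightedCompFun (hp0 : p ≠ 0) (hp : p ≠ ∞) (hw : Measurable w)
    (hpos : ∀ x, 0 < w x)
    (hφ : MeasurePreserving φ (μ.withDensity fun x => ENNReal.ofReal (w x)) μ) {f : α → ℂ}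
    (hf : MemLp f p μ) : MemLp (weightedCompFun p φ w f) p μ := by
  refine ⟨?_, (eLpNorm_weightedCompFun hp0 hp hw hpos hφ hf.1).trans_lt hf.2⟩
  refine AEStronglyMeasurable.mul ?_ (hf.1.comp_quasiMeasurePreserving
    (hφ.quasiMeasurePreserving_of_withDensity hw hpos))
  exact (Complex.measurable_ofReal.comp (hw.pow_const _)).aestronglyMeasurable

/-- The isometry `f ↦ w ^ (1 / p) * (f ∘ φ)` of `L^p` attached to a map `φ` that transports the
measure with density `w` to the reference measure. -/
noncomputable def weightedComp [Fact (1 ≤ p)] (hp : p ≠ ∞) (hw : Measurable w)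
    (hpos : ∀ x, 0 < w x)
    (hφ : MeasurePreserving φ (μ.withDensity fun x => ENNReal.ofReal (w x)) μ) :
    Lp ℂ p μ →ₗᵢ[ℂ] Lp ℂ p μ where
  toFun f := ((Lp.memLp f).weightedCompFun (zero_lt_one.trans_le Fact.out).ne' hp hw hpos hφ).toLp _
  map_add' f g := by
    rw [← MemLp.toLp_add]
    refine MemLp.toLp_congr _ _ ?_
    refine (weightedCompFun_congr_ae hw hpos hφ (Lp.coeFn_add f g)).trans (ae_of_all _ fun x => ?_)
    simp [weightedCompFun, mul_add]
  map_smul' c f := by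
    rw [RingHom.id_apply, ← MemLp.toLp_const_smul]
    refine MemLp.toLp_congr _ _ ?_
    refine (weightedCompFun_congr_ae hw hpos hφ (Lp.coeFn_smul c f)).trans
      (ae_of_all _ fun x => ?_)
    simp [weightedCompFun, mul_left_comm]
  norm_map' f := by
    simp only [LinearMap.coe_mk, AddHom.coe_mk]
    rw [Lp.norm_toLp, eLpNorm_weightedCompFun (zero_lt_one.trans_le Fact.out).ne' hp hw hpos hφ
      (Lp.memLp f).1, Lp.norm_def]

theorem coeFn_weightedComp [Fact (1 ≤ p)] (hp : p ≠ ∞) (hw : Measurable w)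
    (hpos : ∀ x, 0 < w x)
    (hφ : MeasurePreserving φ (μ.withDensity fun x => ENNReal.ofReal (w x)) μ) (f : Lp ℂ p μ) :
    weightedComp hp hw hpos hφ f =ᵐ[μ] weightedCompFun p φ w f :=
  MemLp.coeFn_toLp
    ((Lp.memLp f).weightedCompFun (zero_lt_one.trans_le Fact.out).ne' hp hw hpos hφ)

/-- A right inverse is the weighted composition with `ψ` and `v`; the weights cancel by the chain
rule relation `w * (v ∘ φ) = 1`. -/
theorem surjective_weightedComp [Fact (1 ≤ p)] (hp : p ≠ ∞) (hw : Measurable w)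
    (hpos : ∀ x, 0 < w x)
    (hφ : MeasurePreserving φ (μ.withDensity fun x => ENNReal.ofReal (w x)) μ)
    {ψ : α → α} {v : α → ℝ} (hv : Measurable v) (hvpos : ∀ x, 0 < v x)
    (hψ : MeasurePreserving ψ (μ.withDensity fun x => ENNReal.ofReal (v x)) μ)
    (hinv : Function.LeftInverse ψ φ) (hvw : ∀ᵐ x ∂μ, w x * v (φ x) = 1) :
    Function.Surjective (weightedComp (p := p) hp hw hpos hφ) := by
  refine fun f => ⟨weightedComp hp hv hvpos hψ f, Lp.ext ?_⟩
  refine (coeFn_weightedComp hp hw hpos hφ _).trans ?_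
  refine (weightedCompFun_congr_ae hw hpos hφ (coeFn_weightedComp hp hv hvpos hψ f)).trans ?_
  filter_upwards [hvw] with x hx
  rw [weightedCompFun, weightedCompFun, hinv x, ← mul_assoc, ← Complex.ofReal_mul,
    ← Real.mul_rpow (hpos x).le (hvpos _).le, hx, Real.one_rpow, Complex.ofReal_one, one_mul]

end WeightedComposition

/-! ### Piecewise affine stretches of an interval -/

section Stretch

variable {a b s t : ℝ}

/-- The piecewise affine bijection of `ℝ` that is the identity off `(a, b)` and maps `[a, s]` onto
`[a, t]` and `[s, b]` onto `[t, b]`. -/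
noncomputable def stretch (a b s t x : ℝ) : ℝ :=
  if x ≤ a ∨ b ≤ x then x
  else if x ≤ s then a + (x - a) * ((t - a) / (s - a)) else b - (b - x) * ((b - t) / (b - s))

/-- The slope of `stretch a b s t`. -/
noncomputable def stretchSlope (a b s t x : ℝ) : ℝ :=
  if x ≤ a ∨ b ≤ x then 1 else if x ≤ s then (t - a) / (s - a) else (b - t) / (b - s)

theorem stretch_of_notMem {x : ℝ} (hx : x ∉ Set.Ioo a b) : stretch a b s t x = x :=
  if_pos (by rw [Set.mem_Ioo] at hx; by_contra! h; exact hx h)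

theorem stretch_of_le {x : ℝ} (hax : a < x) (hxs : x ≤ s) (hs : s < b) :
    stretch a b s t x = a + (x - a) * ((t - a) / (s - a)) := by
  rw [stretch, if_neg (by push Not; exact ⟨hax, hxs.trans_lt hs⟩), if_pos hxs]

theorem stretch_of_lt {x : ℝ} (has : a < s) (hsx : s < x) (hxb : x < b) :
    stretch a b s t x = b - (b - x) * ((b - t) / (b - s)) := by
  rw [stretch, if_neg (by push Not; exact ⟨has.trans hsx, hxb⟩), if_neg hsx.not_ge]

theorem stretchSlope_of_notMem {x : ℝ} (hx : x ∉ Set.Ioo a b) : stretchSlope a b s t x = 1 :=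
  if_pos (by rw [Set.mem_Ioo] at hx; by_contra! h; exact hx h)

theorem stretchSlope_of_le {x : ℝ} (hax : a < x) (hxs : x ≤ s) (hs : s < b) :
    stretchSlope a b s t x = (t - a) / (s - a) := by
  rw [stretchSlope, if_neg (by push Not; exact ⟨hax, hxs.trans_lt hs⟩), if_pos hxs]

theorem stretchSlope_of_lt {x : ℝ} (has : a < s) (hsx : s < x) (hxb : x < b) :
    stretchSlope a b s t x = (b - t) / (b - s) := by
  rw [stretchSlope, if_neg (by push Not; exact ⟨has.trans hsx, hxb⟩), if_neg hsx.not_ge]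

theorem measurable_stretch : Measurable (stretch a b s t) := by
  unfold stretch
  refine Measurable.ite (measurableSet_Iic.union measurableSet_Ici) measurable_id
    (Measurable.ite measurableSet_Iic ?_ ?_) <;> fun_prop

theorem measurable_stretchSlope : Measurable (stretchSlope a b s t) := by
  unfold stretchSlope
  exact Measurable.ite (measurableSet_Iic.union measurableSet_Ici) measurable_const
    (Measurable.ite measurableSet_Iic measurable_const measurable_const)

theorem stretch_mem_Ioc {x : ℝ} (ht : a < t) (hs : s < b) (hx : x ∈ Set.Ioc a s) :
    stretch a b s t x ∈ Set.Ioc a t := by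
  have h1 : 0 < x - a := sub_pos.2 hx.1
  have h2 : 0 < s - a := sub_pos.2 (hx.1.trans_le hx.2)
  have h3 : 0 < t - a := sub_pos.2 ht
  rw [stretch_of_le hx.1 hx.2 hs]
  constructor
  · have : 0 < (x - a) * ((t - a) / (s - a)) := by positivity
    linarith
  · have : (x - a) * ((t - a) / (s - a)) ≤ (s - a) * ((t - a) / (s - a)) := by
      gcongr; exact hx.2
    rw [mul_div_cancel₀ _ h2.ne'] at this
    linarith

theorem stretch_mem_Ioo {x : ℝ} (ht : t < b) (has : a < s) (hx : x ∈ Set.Ioo s b) :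
    stretch a b s t x ∈ Set.Ioo t b := by
  have h1 : 0 < b - x := sub_pos.2 hx.2
  have h2 : 0 < b - s := sub_pos.2 (hx.1.trans hx.2)
  have h3 : 0 < b - t := sub_pos.2 ht
  rw [stretch_of_lt has hx.1 hx.2]
  constructor
  · have : (b - x) * ((b - t) / (b - s)) < (b - s) * ((b - t) / (b - s)) := by
      gcongr; exact hx.1
    rw [mul_div_cancel₀ _ h2.ne'] at this
    linarith
  · have : 0 < (b - x) * ((b - t) / (b - s)) := by positivity
    linarith

theorem mem_cases (a b s x : ℝ) : x ∈ Set.Ioc a s ∨ x ∈ Set.Ioo s b ∨ x ∉ Set.Ioo a b := by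
  simp only [Set.mem_Ioc, Set.mem_Ioo]
  by_cases h : a < x <;> by_cases h' : x ≤ s <;> by_cases h'' : x < b <;> grind

/-- The family is closed under inversion: exchanging `s` and `t` inverts each affine piece. -/
theorem leftInverse_stretch (hs : s ∈ Set.Ioo a b) (ht : t ∈ Set.Ioo a b) :
    Function.LeftInverse (stretch a b t s) (stretch a b s t) := by
  intro x
  have h1 := (sub_pos.2 hs.1).ne'
  have h2 := (sub_pos.2 hs.2).ne'
  have h3 := (sub_pos.2 ht.1).ne'
  have h4 := (sub_pos.2 ht.2).ne'
  rcases mem_cases a b s x with h | h | h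
  · have := stretch_mem_Ioc ht.1 hs.2 h
    rw [stretch_of_le this.1 this.2 ht.2, stretch_of_le h.1 h.2 hs.2]
    field_simp
    ring
  · have := stretch_mem_Ioo ht.2 hs.1 h
    rw [stretch_of_lt ht.1 this.1 this.2, stretch_of_lt hs.1 h.1 h.2]
    field_simp
    ring
  · rw [stretch_of_notMem h, stretch_of_notMem h]

theorem stretchSlope_mul_stretchSlope (hs : s ∈ Set.Ioo a b) (ht : t ∈ Set.Ioo a b) (x : ℝ) :
    stretchSlope a b s t x * stretchSlope a b t s (stretch a b s t x) = 1 := by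
  have h1 := (sub_pos.2 hs.1).ne'
  have h2 := (sub_pos.2 hs.2).ne'
  have h3 := (sub_pos.2 ht.1).ne'
  have h4 := (sub_pos.2 ht.2).ne'
  rcases mem_cases a b s x with h | h | h
  · have := stretch_mem_Ioc ht.1 hs.2 h
    rw [stretchSlope_of_le this.1 this.2 ht.2, stretchSlope_of_le h.1 h.2 hs.2]
    field_simp
  · have := stretch_mem_Ioo ht.2 hs.1 h
    rw [stretchSlope_of_lt ht.1 this.1 this.2, stretchSlope_of_lt hs.1 h.1 h.2]
    field_simp
  · rw [stretch_of_notMem h, stretchSlope_of_notMem h, stretchSlope_of_notMem h, one_mul]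

theorem stretchSlope_pos (hs : s ∈ Set.Ioo a b) (ht : t ∈ Set.Ioo a b) (x : ℝ) :
    0 < stretchSlope a b s t x := by
  have h1 := sub_pos.2 hs.1
  have h2 := sub_pos.2 hs.2
  have h3 := sub_pos.2 ht.1
  have h4 := sub_pos.2 ht.2
  unfold stretchSlope
  split_ifs <;> positivity

theorem stretch_preimage_Iic (hs : s ∈ Set.Ioo a b) (ht : t ∈ Set.Ioo a b) :
    stretch a b s t ⁻¹' Set.Iic t = Set.Iic s := by
  ext x
  rw [Set.mem_preimage, Set.mem_Iic, Set.mem_Iic]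
  rcases mem_cases a b s x with h | h | h
  · exact iff_of_true (stretch_mem_Ioc ht.1 hs.2 h).2 h.2
  · exact iff_of_false (stretch_mem_Ioo ht.2 hs.1 h).1.not_ge h.1.not_ge
  · rw [stretch_of_notMem h]
    simp only [Set.mem_Ioo] at *
    grind

theorem stretch_preimage_Ioc (hs : s ∈ Set.Ioo a b) (ht : t ∈ Set.Ioo a b) :
    stretch a b s t ⁻¹' Set.Ioc a t = Set.Ioc a s := by
  ext x
  rw [Set.mem_preimage]
  rcases mem_cases a b s x with h | h | h
  · exact iff_of_true (stretch_mem_Ioc ht.1 hs.2 h) h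
  · exact iff_of_false (fun h' => (stretch_mem_Ioo ht.2 hs.1 h).1.not_ge h'.2)
      (fun h' => h.1.not_ge h'.2)
  · rw [stretch_of_notMem h]
    simp only [Set.mem_Ioo, Set.mem_Ioc] at *
    grind

theorem stretch_mem_Ioo_iff (hs : s ∈ Set.Ioo a b) (ht : t ∈ Set.Ioo a b) {x : ℝ} :
    stretch a b s t x ∈ Set.Ioo a b ↔ x ∈ Set.Ioo a b := by
  rcases mem_cases a b s x with h | h | h
  · have := stretch_mem_Ioc ht.1 hs.2 h
    exact iff_of_true ⟨this.1, this.2.trans_lt ht.2⟩ ⟨h.1, h.2.trans_lt hs.2⟩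
  · have := stretch_mem_Ioo ht.2 hs.1 h
    exact iff_of_true ⟨ht.1.trans this.1, this.2⟩ ⟨hs.1.trans h.1, h.2⟩
  · rw [stretch_of_notMem h]

theorem stretch_mem_iff_of_disjoint (hs : s ∈ Set.Ioo a b) (ht : t ∈ Set.Ioo a b) {B : Set ℝ}
    (hB : Disjoint B (Set.Ioo a b)) {x : ℝ} : stretch a b s t x ∈ B ↔ x ∈ B := by
  by_cases h : x ∈ Set.Ioo a b
  · exact iff_of_false (fun h' => Set.disjoint_left.1 hB h' ((stretch_mem_Ioo_iff hs ht).2 h))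
      (fun h' => Set.disjoint_left.1 hB h' h)
  · rw [stretch_of_notMem h]

theorem stretch_mem_iff_of_subset (hs : s ∈ Set.Ioo a b) (ht : t ∈ Set.Ioo a b) {B : Set ℝ}
    (hB : Set.Ioo a b ⊆ B) {x : ℝ} : stretch a b s t x ∈ B ↔ x ∈ B :=
  not_iff_not.1 (stretch_mem_iff_of_disjoint hs ht (B := Bᶜ)
    (Set.disjoint_left.2 fun _ h h' => h (hB h')))

theorem hasDerivAt_stretch {x : ℝ} (has : a < s) (hsb : s < b) (hx : x ∉ ({a, s, b} : Set ℝ)) :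
    HasDerivAt (stretch a b s t) (stretchSlope a b s t x) x := by
  simp only [Set.mem_insert_iff, Set.mem_singleton_iff, not_or] at hx
  obtain ⟨hxa, hxs, hxb⟩ := hx
  rcases lt_or_gt_of_ne hxa with h | h
  · rw [stretchSlope_of_notMem fun h' => h.not_gt h'.1]
    refine (hasDerivAt_id x).congr_of_eventuallyEq ?_
    filter_upwards [Iio_mem_nhds h] with y hy
    exact stretch_of_notMem fun h' => hy.not_gt h'.1
  rcases lt_or_gt_of_ne hxs with h1 | h1
  · rw [stretchSlope_of_le h h1.le hsb]
    refine HasDerivAt.congr_of_eventuallyEq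
      (f := fun y => a + (y - a) * ((t - a) / (s - a))) ?_ ?_
    · simpa using (((hasDerivAt_id x).sub_const a).mul_const ((t - a) / (s - a))).const_add a
    · filter_upwards [Ioo_mem_nhds h h1] with y hy
      exact stretch_of_le hy.1 hy.2.le hsb
  rcases lt_or_gt_of_ne hxb with h2 | h2
  · rw [stretchSlope_of_lt has h1 h2]
    refine HasDerivAt.congr_of_eventuallyEq
      (f := fun y => b - (b - y) * ((b - t) / (b - s))) ?_ ?_
    · simpa using (((hasDerivAt_id x).const_sub b).mul_const ((b - t) / (b - s))).const_sub b
    · filter_upwards [Ioo_mem_nhds h1 h2] with y hy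
      exact stretch_of_lt has hy.1 hy.2
  · rw [stretchSlope_of_notMem fun h' => h2.not_gt h'.2]
    refine (hasDerivAt_id x).congr_of_eventuallyEq ?_
    filter_upwards [Ioi_mem_nhds h2] with y hy
    exact stretch_of_notMem fun h' => hy.not_gt h'.2

theorem measurePreserving_stretch (hs : s ∈ Set.Ioo a b) (ht : t ∈ Set.Ioo a b) :
    MeasurePreserving (stretch a b s t)
      (volume.withDensity fun x => ENNReal.ofReal (stretchSlope a b s t x)) volume := by
  refine ⟨measurable_stretch, Measure.ext fun E hE => ?_⟩
  have hbij : Function.Bijective (stretch a b s t) :=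
    ⟨(leftInverse_stretch hs ht).injective, (leftInverse_stretch ht hs).surjective⟩
  set F : Set ℝ := {a, s, b}
  have hF : F.Finite := Set.toFinite _
  -- Change of variables off the three break points. They and their images are null, so both
  -- integrals extend to the whole line.
  have h1 := lintegral_image_eq_lintegral_abs_deriv_mul (s := Fᶜ) hF.measurableSet.compl
    (fun x hx => (hasDerivAt_stretch (t := t) hs.1 hs.2 hx).hasDerivWithinAt)
    hbij.1.injOn (E.indicator 1)
  rw [Set.image_compl_eq hbij, setLIntegral_congr (compl_mem_ae_iff.2
      ((hF.image _).measure_zero volume) |> fun h => eventuallyEq_univ.2 h),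
    setLIntegral_congr (eventuallyEq_univ.2 (compl_mem_ae_iff.2 (hF.measure_zero volume))),
    Measure.restrict_univ, lintegral_indicator_one hE] at h1
  rw [Measure.map_apply measurable_stretch hE, withDensity_apply _ (measurable_stretch hE), h1,
    ← lintegral_indicator (measurable_stretch hE)]
  refine lintegral_congr fun x => ?_
  rw [abs_of_pos (stretchSlope_pos hs ht x)]
  by_cases hx : stretch a b s t x ∈ E
  · rw [Set.indicator_of_mem (show x ∈ stretch a b s t ⁻¹' E from hx), Set.indicator_of_mem hx]
    simp
  · rw [Set.indicator_of_notMem (show x ∉ stretch a b s t ⁻¹' E from hx),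
      Set.indicator_of_notMem hx, mul_zero]

theorem measurePreserving_stretch_restrict (hs : s ∈ Set.Ioo a b) (ht : t ∈ Set.Ioo a b)
    {B : Set ℝ} (hB : MeasurableSet B) (hab : Set.Ioo a b ⊆ B) :
    MeasurePreserving (stretch a b s t)
      ((volume.restrict B).withDensity fun x => ENNReal.ofReal (stretchSlope a b s t x))
      (volume.restrict B) := by
  have h := (measurePreserving_stretch hs ht).restrict_preimage hB
  rwa [show stretch a b s t ⁻¹' B = B from
    Set.ext fun x => stretch_mem_iff_of_subset hs ht hab, restrict_withDensity hB] at h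

end Stretch

/-! ### Measures on the line determined by initial intervals -/

theorem measure_Ioo_eq_zero_of_measure_Ioc_eq {m : Measure ℝ} [IsFiniteMeasure m] {a b : ℝ}
    (h : ∀ s ∈ Set.Ioo a b, ∀ t ∈ Set.Ioo a b, m (Set.Ioc a s) = m (Set.Ioc a t)) :
    m (Set.Ioo a b) = 0 := by
  rcases le_or_gt b a with hab | hab
  · rw [Set.Ioo_eq_empty hab.not_gt, measure_empty]
  -- The mass of `(a, t]` is constant in `t` and tends to `0` as `t` decreases to `a`, so it is `0`.
  have hzero : ∀ s ∈ Set.Ioo a b, m (Set.Ioc a s) = 0 := by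
    intro s hs
    have h1 := tendsto_measure_biInter_gt (μ := m) (s := fun t => Set.Ioc a t) (a := a)
      (fun r _ => measurableSet_Ioc.nullMeasurableSet)
      (fun i j _ hij => Set.Ioc_subset_Ioc_right hij) ⟨b, hab, measure_ne_top _ _⟩
    have h2 : (⋂ r > a, Set.Ioc a r) = ∅ := by
      refine Set.eq_empty_of_forall_notMem fun x hx => ?_
      simp only [Set.mem_iInter, Set.mem_Ioc] at hx
      have h3 := (hx b hab).1
      have := (hx ((a + x) / 2) (by linarith)).2
      linarith
    rw [h2, measure_empty] at h1
    refine tendsto_nhds_unique (tendsto_const_nhds.congr' ?_) h1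
    filter_upwards [Ioo_mem_nhdsGT hab] with t ht
    exact h s hs t ht
  obtain ⟨u, -, hu, hlim⟩ := exists_seq_strictMono_tendsto' hab
  refine measure_mono_null (t := ⋃ n, Set.Ioc a (u n)) (fun x hx => ?_)
    (measure_iUnion_null fun n => hzero _ (hu n))
  obtain ⟨n, hn⟩ := (hlim.eventually (lt_mem_nhds hx.2)).exists
  exact Set.mem_iUnion.2 ⟨n, hx.1, hn.le⟩

/-- Lebesgue measure on `[0, 1]`. -/
noncomputable abbrev unitMeasure : Measure ℝ := volume.restrict (Set.Icc (0 : ℝ) 1)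

theorem unitMeasure_Iic {t : ℝ} (ht : t ∈ Set.Ioo (0 : ℝ) 1) :
    unitMeasure (Set.Iic t) = ENNReal.ofReal t := by
  rw [Measure.restrict_apply measurableSet_Iic,
    show Set.Iic t ∩ Set.Icc (0 : ℝ) 1 = Set.Icc 0 t by
      ext x; simp only [Set.mem_inter_iff, Set.mem_Iic, Set.mem_Icc, Set.mem_Ioo] at *; grind,
    Real.volume_Icc, sub_zero]

theorem measure_eq_smul_unitMeasure {m : Measure ℝ} [IsFiniteMeasure m] (hm : m ≪ unitMeasure)
    {C : ℝ≥0∞} (hC : C ≠ ∞)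
    (h : ∀ t ∈ Set.Ioo (0 : ℝ) 1, m (Set.Iic t) = C * ENNReal.ofReal t) :
    m = C • unitMeasure := by
  obtain ⟨u, humono, hu, hlim⟩ := exists_seq_strictMono_tendsto' (zero_lt_one (α := ℝ))
  have hU : ⋃ n, Set.Iic (u n) = Set.Iio (1 : ℝ) :=
    iUnion_Iic_eq_Iio_of_lt_of_tendsto (fun n => (hu n).2) hlim
  have hmono : Monotone fun n => Set.Iic (u n) := fun i j hij =>
    Set.Iic_subset_Iic.2 (humono.monotone hij)
  have h1 := tendsto_measure_iUnion_atTop (μ := m) hmono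
  have h2 := ENNReal.Tendsto.const_mul (a := C) (tendsto_measure_iUnion_atTop (μ := unitMeasure) hmono)
    (Or.inr hC)
  rw [hU] at h1 h2
  -- The hypothesis covers only `t < 1`; the mass of `(-∞, 1)` comes by continuity from below along
  -- `u n → 1`.
  have h3 : m (Set.Iio 1) = C * unitMeasure (Set.Iio 1) := by
    refine tendsto_nhds_unique h1 (h2.congr fun n => ?_)
    simp only [Function.comp_apply]
    rw [h _ (hu n), unitMeasure_Iic (hu n)]
  have hge : unitMeasure (Set.Ici 1) = 0 := by
    rw [Measure.restrict_apply measurableSet_Ici]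
    exact measure_mono_null (t := {1}) (fun x hx => le_antisymm hx.2.2 hx.1) (measure_singleton 1)
  refine Measure.ext_of_Iic _ _ fun t => ?_
  rw [Measure.smul_apply, smul_eq_mul]
  rcases le_or_gt t 0 with h0 | h0
  · have : unitMeasure (Set.Iic t) = 0 := by
      rw [Measure.restrict_apply measurableSet_Iic]
      refine measure_mono_null (t := {0}) (fun x hx => ?_) (measure_singleton 0)
      exact le_antisymm (hx.1.trans h0) hx.2.1
    rw [this, hm this, mul_zero]
  rcases lt_or_ge t 1 with h1' | h1'
  · rw [h t ⟨h0, h1'⟩, unitMeasure_Iic ⟨h0, h1'⟩]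
  -- Neither measure charges `[1, ∞)`, so for `t ≥ 1` everything reduces to `(-∞, 1)`.
  · have key : ∀ ν : Measure ℝ, ν (Set.Ici 1) = 0 → ν (Set.Iic t) = ν (Set.Iio 1) := fun ν hν => by
      refine le_antisymm ?_ (measure_mono fun x hx => (le_of_lt hx).trans h1')
      calc ν (Set.Iic t) ≤ ν (Set.Iio 1 ∪ Set.Ici 1) := measure_mono fun x _ => lt_or_ge x 1
        _ ≤ ν (Set.Iio 1) + ν (Set.Ici 1) := measure_union_le _ _
        _ = ν (Set.Iio 1) := by rw [hν, add_zero]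
    rw [key _ (hm hge), key _ hge, h3]

/-! ### The commutant of the positive invertible isometries -/

section Commutant

variable {p : ℝ≥0∞}

theorem weightedCompFun_stretch_congr_ae {a b s t : ℝ} (ha : 0 ≤ a) (hb : b ≤ 1)
    (hs : s ∈ Set.Ioo a b) (ht : t ∈ Set.Ioo a b) {f g : ℝ → ℂ} (h : f =ᵐ[unitMeasure] g) :
    weightedCompFun p (stretch a b s t) (stretchSlope a b s t) f =ᵐ[unitMeasure]
      weightedCompFun p (stretch a b s t) (stretchSlope a b s t) g :=
  weightedCompFun_congr_ae measurable_stretchSlope (stretchSlope_pos hs ht)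
    (measurePreserving_stretch_restrict hs ht measurableSet_Icc
      fun _ hx => ⟨ha.trans hx.1.le, hx.2.le.trans hb⟩) h

/-- The indicator function of a measurable set, as an element of `L^p[0,1]`. -/
noncomputable def unitIndicator (p : ℝ≥0∞) {B : Set ℝ} (hB : MeasurableSet B) : LpUnit p :=
  indicatorConstLp p hB (measure_ne_top _ _) 1

theorem coeFn_unitIndicator {B : Set ℝ} (hB : MeasurableSet B) :
    unitIndicator p hB =ᵐ[unitMeasure] B.indicator fun _ => (1 : ℂ) :=
  indicatorConstLp_coeFn

variable [Fact (1 ≤ p)]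

theorem exists_stretch_isometry (hp : p ≠ ∞) {a b s t : ℝ} (ha : 0 ≤ a) (hb : b ≤ 1)
    (hs : s ∈ Set.Ioo a b) (ht : t ∈ Set.Ioo a b) :
    ∃ T ∈ positiveInvertibleIsometries p, ∀ f : LpUnit p,
      T f =ᵐ[unitMeasure] weightedCompFun p (stretch a b s t) (stretchSlope a b s t) f := by
  have hsub : Set.Ioo a b ⊆ Set.Icc 0 1 := fun x hx => ⟨ha.trans hx.1.le, hx.2.le.trans hb⟩
  have hφ := measurePreserving_stretch_restrict hs ht measurableSet_Icc hsub
  have hψ := measurePreserving_stretch_restrict ht hs measurableSet_Icc hsub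
  have hT := coeFn_weightedComp (p := p) hp measurable_stretchSlope (stretchSlope_pos hs ht) hφ
  refine ⟨(weightedComp hp measurable_stretchSlope
    (stretchSlope_pos hs ht) hφ).toContinuousLinearMap, ⟨fun f hf => ?_, fun f => ?_, ?_⟩, hT⟩
  · filter_upwards [hT f, (hφ.quasiMeasurePreserving_of_withDensity measurable_stretchSlope
      (stretchSlope_pos hs ht)).ae hf] with x hx hx'
    rw [LinearIsometry.coe_toContinuousLinearMap, hx, weightedCompFun, Complex.re_ofReal_mul,
      Complex.im_ofReal_mul, hx'.2, mul_zero]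
    exact ⟨mul_nonneg (Real.rpow_nonneg (stretchSlope_pos hs ht x).le _) hx'.1, rfl⟩
  · exact LinearIsometry.norm_map _ f
  · exact surjective_weightedComp hp measurable_stretchSlope (stretchSlope_pos hs ht) hφ measurable_stretchSlope
      (stretchSlope_pos ht hs) hψ (leftInverse_stretch hs ht)
      (ae_of_all _ (stretchSlope_mul_stretchSlope hs ht))

theorem setLIntegral_weightedCompFun_stretch (hp : p ≠ ∞) {a b s t : ℝ} (ha : 0 ≤ a) (hb : b ≤ 1)
    (hs : s ∈ Set.Ioo a b) (ht : t ∈ Set.Ioo a b) (f : LpUnit p) {B : Set ℝ}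
    (hB : MeasurableSet B) :
    ∫⁻ x in stretch a b s t ⁻¹' B,
        ‖weightedCompFun p (stretch a b s t) (stretchSlope a b s t) f x‖ₑ ^ p.toReal ∂unitMeasure
      = ∫⁻ x in B, ‖f x‖ₑ ^ p.toReal ∂unitMeasure :=
  setLIntegral_weightedCompFun (zero_lt_one.trans_le Fact.out).ne' hp measurable_stretchSlope
    (stretchSlope_pos hs ht) (measurePreserving_stretch_restrict hs ht measurableSet_Icc
      fun _ hx => ⟨ha.trans hx.1.le, hx.2.le.trans hb⟩) (Lp.aestronglyMeasurable f) hB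

theorem lintegral_enorm_rpow_ne_top (hp : p ≠ ∞) (f : LpUnit p) :
    ∫⁻ x, ‖f x‖ₑ ^ p.toReal ∂unitMeasure ≠ ∞ :=
  (lintegral_rpow_enorm_lt_top_of_eLpNorm_lt_top (zero_lt_one.trans_le Fact.out).ne' hp
    (Lp.eLpNorm_lt_top f)).ne

/-- Locality of `V`: a stretch of `(a, b)` fixes `1_B`, so by commutation it fixes `g = V 1_B`.
Since it carries `(a, s]` to `(a, t]`, the measure `|g|^p dx` gives these equal mass, for all `s`
and `t`. -/
theorem apply_unitIndicator_eq_zero (hp : p ≠ ∞) {V : LpUnit p →L[ℂ] LpUnit p}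
    (hV : ∀ T ∈ positiveInvertibleIsometries p, ∀ f, V (T f) = T (V f)) {a b : ℝ} (ha : 0 ≤ a)
    (hb : b ≤ 1) {B : Set ℝ} (hB : MeasurableSet B) (hdisj : Disjoint B (Set.Ioo a b)) :
    ∀ᵐ x ∂unitMeasure, x ∈ Set.Ioo a b → V (unitIndicator p hB) x = 0 := by
  have hp0 : 0 < p.toReal := ENNReal.toReal_pos (zero_lt_one.trans_le Fact.out).ne' hp
  set g := V (unitIndicator p hB) with hg
  have hgm : AEMeasurable (fun x => ‖g x‖ₑ ^ p.toReal) unitMeasure :=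
    (Lp.aestronglyMeasurable g).enorm.pow_const _
  have : IsFiniteMeasure (unitMeasure.withDensity fun x => ‖g x‖ₑ ^ p.toReal) :=
    isFiniteMeasure_withDensity (lintegral_enorm_rpow_ne_top hp g)
  have h0 := measure_Ioo_eq_zero_of_measure_Ioc_eq
    (m := unitMeasure.withDensity fun x => ‖g x‖ₑ ^ p.toReal) (a := a) (b := b) ?_
  · rw [withDensity_apply _ measurableSet_Ioo, lintegral_eq_zero_iff' hgm.restrict] at h0
    refine (ae_restrict_iff' measurableSet_Ioo).1 (h0.mono fun x hx => ?_)
    simpa [ENNReal.rpow_eq_zero_iff, hp0, hp0.not_gt] using hx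
  · intro s hs t ht
    obtain ⟨T, hT, hTf⟩ := exists_stretch_isometry hp ha hb hs ht
    have h1 : T (unitIndicator p hB) = unitIndicator p hB := by
      refine Lp.ext ((hTf _).trans ?_)
      refine (weightedCompFun_stretch_congr_ae ha hb hs ht (coeFn_unitIndicator hB)).trans
        (EventuallyEq.trans (ae_of_all _ fun x => ?_) (coeFn_unitIndicator hB).symm)
      rw [weightedCompFun]
      by_cases hx : x ∈ B
      · have hx' := Set.disjoint_left.1 hdisj hx
        rw [stretch_of_notMem hx', stretchSlope_of_notMem hx', Real.one_rpow, Complex.ofReal_one,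
          one_mul]
      · rw [Set.indicator_of_notMem hx, Set.indicator_of_notMem
          fun h => hx ((stretch_mem_iff_of_disjoint hs ht hdisj).1 h), mul_zero]
    have h2 : T g = g := by rw [hg, ← hV T hT, h1]
    have h3 := hTf g
    rw [h2] at h3
    rw [withDensity_apply _ measurableSet_Ioc, withDensity_apply _ measurableSet_Ioc,
      ← setLIntegral_weightedCompFun_stretch hp ha hb hs ht g (measurableSet_Ioc (a := a) (b := t)),
      stretch_preimage_Ioc hs ht]
    exact lintegral_congr_ae (ae_restrict_of_ae (h3.mono fun x hx => by simp only [← hx]))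

/-- Write `1 = 1_{x ≤ t} + 1_{x > t}`. By locality the image of the first term vanishes on `(t, 1)`
and that of the second on `(0, t)`. -/
theorem apply_unitIndicator_Iic (hp : p ≠ ∞) {V : LpUnit p →L[ℂ] LpUnit p}
    (hV : ∀ T ∈ positiveInvertibleIsometries p, ∀ f, V (T f) = T (V f)) {t : ℝ}
    (ht : t ∈ Set.Ioo (0 : ℝ) 1) :
    V (unitIndicator p (measurableSet_Iic (a := t))) =ᵐ[unitMeasure]
      (Set.Iic t).indicator (V (unitIndicator p MeasurableSet.univ)) := by
  have hsum : unitIndicator p (MeasurableSet.univ (α := ℝ))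
      = unitIndicator p (measurableSet_Iic (a := t))
        + unitIndicator p (measurableSet_Ioi (a := t)) := by
    rw [unitIndicator, unitIndicator, unitIndicator, ← indicatorConstLp_disjoint_union _ _ _ _
      (Set.Iic_disjoint_Ioi le_rfl)]
    simp only [Set.Iic_union_Ioi]
  have h1 := apply_unitIndicator_eq_zero hp hV (a := t) (b := 1) ht.1.le le_rfl
    (measurableSet_Iic (a := t)) (Set.disjoint_left.2 fun x hx hx' => hx'.1.not_ge hx)
  have h2 := apply_unitIndicator_eq_zero hp hV (a := 0) (b := t) le_rfl ht.2.le
    (measurableSet_Ioi (a := t)) (Set.disjoint_left.2 fun x hx hx' => hx'.2.not_gt hx)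
  have h3 : ∀ᵐ x ∂unitMeasure, x ∉ ({0, t, 1} : Set ℝ) :=
    ae_restrict_of_ae (compl_mem_ae_iff.2 ((Set.toFinite _).measure_zero _))
  have h4 : ∀ᵐ x ∂unitMeasure, x ∈ Set.Icc (0 : ℝ) 1 := ae_restrict_mem measurableSet_Icc
  have h5 := Lp.coeFn_add (V (unitIndicator p (measurableSet_Iic (a := t))))
    (V (unitIndicator p (measurableSet_Ioi (a := t))))
  rw [← map_add, ← hsum] at h5
  filter_upwards [h1, h2, h3, h4, h5] with x h1 h2 h3 h4 h5
  simp only [Set.mem_insert_iff, Set.mem_singleton_iff, not_or] at h3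
  rcases lt_or_gt_of_ne h3.2.1 with h | h
  · rw [Set.indicator_of_mem (show x ∈ Set.Iic t from h.le), h5, Pi.add_apply,
      h2 ⟨lt_of_le_of_ne h4.1 (Ne.symm h3.1), h⟩, add_zero]
  · rw [Set.indicator_of_notMem (show x ∉ Set.Iic t from h.not_ge),
      h1 ⟨h, lt_of_le_of_ne h4.2 h3.2.2⟩]

/-- The stretch of `(0, 1)` taking `s` to `t` has slope `t / s` on `(0, s]`, so its isometry `T`
maps `1_{x ≤ t}` to `(t / s)^(1/p) • 1_{x ≤ s}`. Apply `V`, commute it past `T`, and compare `p`-th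
powers of norms. -/
theorem setLIntegral_apply_one_Iic (hp : p ≠ ∞) {V : LpUnit p →L[ℂ] LpUnit p}
    (hV : ∀ T ∈ positiveInvertibleIsometries p, ∀ f, V (T f) = T (V f)) {s t : ℝ}
    (hs : s ∈ Set.Ioo (0 : ℝ) 1) (ht : t ∈ Set.Ioo (0 : ℝ) 1) :
    ∫⁻ x in Set.Iic t, ‖V (unitIndicator p MeasurableSet.univ) x‖ₑ ^ p.toReal ∂unitMeasure
      = ENNReal.ofReal (t / s) *
        ∫⁻ x in Set.Iic s, ‖V (unitIndicator p MeasurableSet.univ) x‖ₑ ^ p.toReal ∂unitMeasure := by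
  have hp0 : 0 < p.toReal := ENNReal.toReal_pos (zero_lt_one.trans_le Fact.out).ne' hp
  have hts : 0 < t / s := div_pos ht.1 hs.1
  obtain ⟨T, hT, hTf⟩ := exists_stretch_isometry hp le_rfl le_rfl hs ht
  set c : ℝ := (t / s) ^ (1 / p.toReal) with hc
  have h1 : T (unitIndicator p (measurableSet_Iic (a := t)))
      = (c : ℂ) • unitIndicator p (measurableSet_Iic (a := s)) := by
    refine Lp.ext ((hTf _).trans ?_)
    refine (weightedCompFun_stretch_congr_ae le_rfl le_rfl hs ht (coeFn_unitIndicator _)).trans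
      (EventuallyEq.trans ?_ (Lp.coeFn_smul _ _).symm)
    have h3 : ∀ᵐ x ∂unitMeasure, x ∉ ({0} : Set ℝ) :=
      ae_restrict_of_ae (compl_mem_ae_iff.2 ((Set.toFinite _).measure_zero _))
    filter_upwards [coeFn_unitIndicator (p := p) (measurableSet_Iic (a := s)), h3,
      ae_restrict_mem measurableSet_Icc] with x h1 h3 h4
    rw [Pi.smul_apply, h1, weightedCompFun]
    have hiff : stretch 0 1 s t x ∈ Set.Iic t ↔ x ∈ Set.Iic s :=
      Set.ext_iff.1 (stretch_preimage_Iic hs ht) x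
    by_cases hx : x ∈ Set.Iic s
    · rw [Set.indicator_of_mem hx, Set.indicator_of_mem (hiff.2 hx),
        stretchSlope_of_le (lt_of_le_of_ne h4.1 (Ne.symm h3)) hx hs.2, sub_zero, sub_zero,
        smul_eq_mul]
    · rw [Set.indicator_of_notMem hx, Set.indicator_of_notMem (hx ∘ hiff.1), mul_zero, smul_zero]
  have h2 : T (V (unitIndicator p (measurableSet_Iic (a := t))))
      = (c : ℂ) • V (unitIndicator p (measurableSet_Iic (a := s))) := by
    rw [← hV T hT, h1, map_smul]
  have hnorm : ∀ r ∈ Set.Ioo (0 : ℝ) 1,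
      ∫⁻ x in Set.Iic r, ‖V (unitIndicator p MeasurableSet.univ) x‖ₑ ^ p.toReal ∂unitMeasure
        = ∫⁻ x, ‖V (unitIndicator p (measurableSet_Iic (a := r))) x‖ₑ ^ p.toReal ∂unitMeasure := by
    intro r hr
    rw [← lintegral_indicator measurableSet_Iic]
    refine lintegral_congr_ae ((apply_unitIndicator_Iic hp hV hr).mono fun x hx => ?_)
    dsimp only
    rw [hx]
    by_cases h : x ∈ Set.Iic r
    · rw [Set.indicator_of_mem h, Set.indicator_of_mem h]
    · rw [Set.indicator_of_notMem h, Set.indicator_of_notMem h, enorm_zero,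
        ENNReal.zero_rpow_of_pos hp0]
  rw [hnorm t ht, hnorm s hs, ← lintegral_const_mul'' _
    ((Lp.aestronglyMeasurable _).enorm.pow_const _)]
  have h3 := setLIntegral_weightedCompFun_stretch hp le_rfl le_rfl hs ht
    (V (unitIndicator p (measurableSet_Iic (a := t)))) MeasurableSet.univ
  rw [Set.preimage_univ, Measure.restrict_univ] at h3
  rw [← h3]
  have h4 := hTf (V (unitIndicator p (measurableSet_Iic (a := t))))
  rw [h2] at h4
  refine lintegral_congr_ae ?_
  filter_upwards [h4, Lp.coeFn_smul (c : ℂ) (V (unitIndicator p (measurableSet_Iic (a := s))))]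
    with x hx hx'
  have hc0 : 0 ≤ c := Real.rpow_nonneg hts.le _
  rw [← hx, hx', Pi.smul_apply, enorm_smul, ENNReal.mul_rpow_of_nonneg _ _ hp0.le]
  congr 1
  rw [← ofReal_norm, Complex.norm_real, Real.norm_of_nonneg hc0,
    ENNReal.ofReal_rpow_of_nonneg hc0 hp0.le, hc, ← Real.rpow_mul hts.le,
    one_div_mul_cancel hp0.ne', Real.rpow_one]

theorem exists_apply_one_eq_const (hp : p ≠ ∞) {V : LpUnit p →L[ℂ] LpUnit p}
    (hpos : IsPositiveOperator V)
    (hV : ∀ T ∈ positiveInvertibleIsometries p, ∀ f, V (T f) = T (V f)) :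
    ∃ c : ℝ, 0 ≤ c ∧ ∀ᵐ x ∂unitMeasure, V (unitIndicator p MeasurableSet.univ) x = c := by
  have hp0 : 0 < p.toReal := ENNReal.toReal_pos (zero_lt_one.trans_le Fact.out).ne' hp
  set h := V (unitIndicator p MeasurableSet.univ) with hh
  have hhm : AEMeasurable (fun x => ‖h x‖ₑ ^ p.toReal) unitMeasure :=
    (Lp.aestronglyMeasurable h).enorm.pow_const _
  have hfin := lintegral_enorm_rpow_ne_top hp h
  have hfm : IsFiniteMeasure (unitMeasure.withDensity fun x => ‖h x‖ₑ ^ p.toReal) :=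
    isFiniteMeasure_withDensity hfin
  have hhalf : (1 / 2 : ℝ) ∈ Set.Ioo (0 : ℝ) 1 := by constructor <;> norm_num
  -- The expected constant value of `|h|^p`: the scaling law with reference point `s = 1/2` gives
  -- mass `2 t` times that of `[0, 1/2]`.
  set C : ℝ≥0∞ := ENNReal.ofReal 2 *
    ∫⁻ x in Set.Iic (1 / 2), ‖h x‖ₑ ^ p.toReal ∂unitMeasure with hC
  have hCtop : C ≠ ∞ := ENNReal.mul_ne_top ENNReal.ofReal_ne_top
    (ne_top_of_le_ne_top hfin (setLIntegral_le_lintegral _ _))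
  have hmeas := measure_eq_smul_unitMeasure (withDensity_absolutelyContinuous _ _) hCtop
    (m := unitMeasure.withDensity fun x => ‖h x‖ₑ ^ p.toReal) fun t ht => by
      rw [withDensity_apply _ measurableSet_Iic, hh, setLIntegral_apply_one_Iic hp hV hhalf ht, hC,
        div_div_eq_mul_div, div_one, ENNReal.ofReal_mul ht.1.le, hh]
      ring
  rw [← withDensity_const, withDensity_eq_iff hhm aemeasurable_const hfin] at hmeas
  have hnonneg : h.IsNonneg := hpos _ <| by
    filter_upwards [coeFn_unitIndicator (p := p) MeasurableSet.univ] with x hx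
    rw [hx]
    simp
  -- Only `|h|` is determined by the measure; positivity of `V` gives `h = |h|`.
  refine ⟨(C ^ (1 / p.toReal)).toReal, ENNReal.toReal_nonneg, ?_⟩
  filter_upwards [hmeas, hnonneg] with x hx hx'
  rw [← hx, ← ENNReal.rpow_mul, mul_one_div_cancel hp0.ne', ENNReal.rpow_one, toReal_enorm]
  have hre : h x = ((h x).re : ℂ) := Complex.ext rfl hx'.2
  rw [hre, Complex.norm_real, Real.norm_of_nonneg hx'.1]

/-- The half-lines form a π-system generating the Borel sets, and the sets on whose indicators `V`
and `W` agree form a λ-system. Density of simple functions in `L^p`, `p < ∞`, does the rest. -/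
theorem clm_ext_of_unitIndicator_Iic (hp : p ≠ ∞) {V W : LpUnit p →L[ℂ] LpUnit p}
    (huniv : V (unitIndicator p MeasurableSet.univ) = W (unitIndicator p MeasurableSet.univ))
    (hIic : ∀ t ∈ Set.Ioo (0 : ℝ) 1, V (unitIndicator p (measurableSet_Iic (a := t)))
      = W (unitIndicator p (measurableSet_Iic (a := t)))) : V = W := by
  have hcongr : ∀ {A B : Set ℝ} (hA : MeasurableSet A) (hB : MeasurableSet B),
      A =ᵐ[unitMeasure] B → unitIndicator p hA = unitIndicator p hB := fun hA hB h =>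
    Lp.ext ((coeFn_unitIndicator hA).trans
      ((indicator_ae_eq_of_ae_eq_set h).trans (coeFn_unitIndicator hB).symm))
  have hdiff : ∀ {A : Set ℝ} (hA : MeasurableSet A),
      V (unitIndicator p hA) = W (unitIndicator p hA) →
      V (unitIndicator p hA.compl) = W (unitIndicator p hA.compl) := by
    intro A hA h
    have hsum : unitIndicator p (MeasurableSet.univ (α := ℝ))
        = unitIndicator p hA + unitIndicator p hA.compl := by
      rw [unitIndicator, unitIndicator, unitIndicator, ← indicatorConstLp_disjoint_union _ _ _ _
        disjoint_compl_right]
      simp only [Set.union_compl_self]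
    rw [hsum, map_add, map_add, h] at huniv
    exact add_left_cancel huniv
  have hempty : V (unitIndicator p MeasurableSet.empty) = W (unitIndicator p MeasurableSet.empty) := by
    rw [unitIndicator, indicatorConstLp_empty, map_zero, map_zero]
  have hall : ∀ t : ℝ, V (unitIndicator p (measurableSet_Iic (a := t)))
      = W (unitIndicator p (measurableSet_Iic (a := t))) := by
    intro t
    have hmem : ∀ᵐ x ∂unitMeasure, x ∈ Set.Icc (0 : ℝ) 1 := ae_restrict_mem measurableSet_Icc
    have h0 : ∀ᵐ x ∂unitMeasure, x ∉ ({0} : Set ℝ) :=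
      ae_restrict_of_ae (compl_mem_ae_iff.2 ((Set.toFinite _).measure_zero _))
    rcases le_or_gt t 0 with ht | ht
    · rw [hcongr measurableSet_Iic MeasurableSet.empty, hempty]
      refine eventuallyEq_set.2 ?_
      filter_upwards [hmem, h0] with x hx hx0
      exact iff_of_false (fun h => hx0 (le_antisymm (le_trans h ht) hx.1)) id
    rcases lt_or_ge t 1 with ht1 | ht1
    · exact hIic t ⟨ht, ht1⟩
    · rw [hcongr measurableSet_Iic MeasurableSet.univ, huniv]
      refine eventuallyEq_set.2 ?_
      filter_upwards [hmem] with x hx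
      exact iff_of_true (hx.2.trans ht1) trivial
  have hind : ∀ (B : Set ℝ) (hB : MeasurableSet B),
      V (unitIndicator p hB) = W (unitIndicator p hB) := by
    refine MeasurableSpace.induction_on_inter (borel_eq_generateFrom_Iic ℝ ▸
      BorelSpace.measurable_eq) isPiSystem_Iic hempty ?_ (fun t ht h => hdiff ht h) ?_
    · rintro _ ⟨t, rfl⟩
      exact hall t
    · intro f hdisj hf h
      have hfin : ∀ n, MeasurableSet (Set.accumulate f n) := fun n =>
        MeasurableSet.biUnion (Set.to_countable _) fun i _ => hf i
      have hacc : ∀ n, V (unitIndicator p (hfin n)) = W (unitIndicator p (hfin n)) := by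
        intro n
        induction n with
        | zero =>
          have : unitIndicator p (hfin 0) = unitIndicator p (hf 0) := by
            simp only [Set.accumulate_zero_nat]
          rw [this, h 0]
        | succ n ih =>
          have : unitIndicator p (hfin (n + 1))
              = unitIndicator p (hfin n) + unitIndicator p (hf (n + 1)) := by
            rw [unitIndicator, unitIndicator, unitIndicator, ← indicatorConstLp_disjoint_union
              _ _ _ _ (Set.disjoint_accumulate hdisj (Nat.lt_succ_self n))]
            simp only [Set.accumulate_succ]
          rw [this, map_add, map_add, ih, h]
      -- Finite partial unions exhaust the union up to sets of measure tending to `0`, so their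
      -- indicators converge in `L^p`; continuity passes the equality to the limit.
      have hlim : Tendsto (fun n => unitIndicator p (hfin n)) atTop
          (𝓝 (unitIndicator p (MeasurableSet.iUnion hf))) := by
        refine tendsto_indicatorConstLp_set hp ?_
        have h1 : Tendsto (fun n => unitMeasure ((⋃ i, f i) \ Set.accumulate f n)) atTop
            (𝓝 (unitMeasure (⋂ n, (⋃ i, f i) \ Set.accumulate f n))) :=
          tendsto_measure_iInter_atTop
            (fun n => ((MeasurableSet.iUnion hf).diff (hfin n)).nullMeasurableSet)
            (fun i j hij => Set.sdiff_subset_sdiff_right (Set.monotone_accumulate hij))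
            ⟨0, measure_ne_top _ _⟩
        rw [← Set.sdiff_iUnion, Set.iUnion_accumulate, Set.sdiff_self, measure_empty] at h1
        refine h1.congr fun n => ?_
        rw [symmDiff_of_le (Set.accumulate_subset_iUnion n)]
      exact tendsto_nhds_unique ((V.continuous.tendsto _).comp hlim)
        (((W.continuous.tendsto _).comp hlim).congr fun n => (hacc n).symm)
  refine ContinuousLinearMap.ext fun f => ?_
  induction f using Lp.induction hp with
  | @indicatorConst c s hs hμs =>
    have : ((Lp.simpleFunc.indicatorConst p hs hμs.ne c : Lp.simpleFunc ℂ p unitMeasure) :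
        LpUnit p) = c • unitIndicator p hs := by
      rw [Lp.simpleFunc.coe_indicatorConst, unitIndicator]
      refine Lp.ext (indicatorConstLp_coeFn.trans (EventuallyEq.symm ?_))
      filter_upwards [Lp.coeFn_smul c (indicatorConstLp p hs (measure_ne_top unitMeasure _) (1 : ℂ)),
        indicatorConstLp_coeFn (p := p) (hs := hs) (hμs := measure_ne_top unitMeasure _)
          (c := (1 : ℂ))] with x h1 h2
      rw [h1, Pi.smul_apply, h2]
      by_cases hx : x ∈ s <;> simp [Set.indicator, hx]
    rw [this, map_smul, map_smul, hind]
  | add hf hg _ h1 h2 => rw [map_add, map_add, h1, h2]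
  | isClosed => exact isClosed_eq V.continuous W.continuous

end Commutant

/-! ### Conclusion: `V` is a scalar in `[0, 1]` -/

theorem mainTheorem11 (p : ℝ≥0∞) [Fact (1 ≤ p)] (hp : 1 < p) (hp' : p < ⊤)
    (V : LpUnit p →L[ℂ] LpUnit p) (hV : IsPositiveOperator V)
    (hdense :
      IsWOTDenseIn {T | IsPositiveOperator T ∧ V ∈ weakLimitSemigroup T}
          (positiveContractions p) ∨
        IsSOTDenseIn {T | IsPositiveOperator T ∧ V ∈ weakLimitSemigroup T}
          (positiveIsometries p) ∨
        IsSOTDenseIn {T | IsPositiveOperator T ∧ V ∈ weakLimitSemigroup T}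
          (positiveInvertibleIsometries p)) :
    ∃ c : ℝ, c ∈ Set.Icc (0 : ℝ) 1 ∧
      V = (c : ℂ) • ContinuousLinearMap.id ℂ (LpUnit p) := by
  obtain ⟨hcomm, hnorm⟩ := commute_and_contraction_of_dense hdense
  obtain ⟨c, hc0, hc⟩ := exists_apply_one_eq_const hp'.ne hV hcomm
  have huniv : V (unitIndicator p MeasurableSet.univ)
      = (c : ℂ) • unitIndicator p MeasurableSet.univ := by
    refine Lp.ext ?_
    filter_upwards [hc, Lp.coeFn_smul (c : ℂ) (unitIndicator p MeasurableSet.univ),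
      coeFn_unitIndicator (p := p) MeasurableSet.univ] with x h1 h2 h3
    rw [h1, h2, Pi.smul_apply, h3]
    simp
  refine ⟨c, ⟨hc0, ?_⟩, clm_ext_of_unitIndicator_Iic hp'.ne huniv fun t ht => ?_⟩
  -- The constant function `1` has norm `1` on `[0, 1]`, so contractivity reads `c ≤ 1`.
  · have h1 := hnorm (unitIndicator p MeasurableSet.univ)
    have hone : ‖unitIndicator p (MeasurableSet.univ (α := ℝ))‖ = 1 := by
      rw [unitIndicator, norm_indicatorConstLp (zero_lt_one.trans hp).ne' hp'.ne]
      simp [Measure.real]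
    rwa [huniv, norm_smul, hone, mul_one, Complex.norm_real, Real.norm_of_nonneg hc0] at h1
  · refine Lp.ext ((apply_unitIndicator_Iic hp'.ne hcomm ht).trans ?_)
    rw [smul_apply, ContinuousLinearMap.id_apply]
    filter_upwards [hc, Lp.coeFn_smul (c : ℂ) (unitIndicator p (measurableSet_Iic (a := t))),
      coeFn_unitIndicator (p := p) (measurableSet_Iic (a := t))] with x h1 h2 h3
    rw [h2, Pi.smul_apply, h3]
    by_cases hx : x ∈ Set.Iic t <;> simp [Set.indicator, hx, h1]
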